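/- Consider the synchronous message-passing model: the network is an $n$-vertex undirected graph $G=(V,E)$ whose vertices host processors with distinct identity numbers from $\{1,\dots,n\}$; in each round every vertex may send a message to each of its neighbors (messages sent in a round arrive before the next round starts), and local computation and message size are unrestricted. Initially every vertex knows only its own identity number and the parameters $n$ and $a$. The running time is the number of rounds until all vertices have terminated. The arboricity of $G$ is the minimal number of edge-disjoint forests that cover $E$. For every constant $\mu>0$ there are a deterministic distributed algorithm and constants $K,C$, depending only on $\mu$, such that on every $n$-vertex graph $G$ of arboricity at most $a$, where $a\ge 1$, the algorithm computes a legal $Ka$-coloring of $G$ (a map $\varphi:V\to\{1,\dots,Ka\}$ with $\varphi(u)\ne\varphi(v)$ for every edge $(u,v)$) within at most $$C\cdot\bigl(a^{\mu}+(\log_2 n)^{1+\mu}\bigr)$$ rounds. -/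

import Mathlib

/-- The edges of `G` are partitioned into `k` (edge-disjoint) forests on the vertex set `V`. -/
def IsForestDecomposition {V : Type*} (G : SimpleGraph V) (k : ℕ)
    (F : Fin k → SimpleGraph V) : Prop :=
  (∀ i, (F i).IsAcyclic) ∧ (∀ i j, i ≠ j → Disjoint (F i).edgeSet (F j).edgeSet) ∧
    (⋃ i, (F i).edgeSet) = G.edgeSet

/-- The arboricity of `G`: the minimal number of edge-disjoint forests that cover its edge set. -/
noncomputable def arboricity {V : Type*} (G : SimpleGraph V) : ℕ :=
  sInf {k : ℕ | ∃ F : Fin k → SimpleGraph V, IsForestDecomposition G k F}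

/-- On a finite vertex set the minimum in the definition of the arboricity is attained. -/
theorem exists_isForestDecomposition_arboricity {V : Type*} [Finite V] (G : SimpleGraph V) :
    ∃ F : Fin (arboricity G) → SimpleGraph V, IsForestDecomposition G (arboricity G) F := by
  have hne : {k : ℕ | ∃ F : Fin k → SimpleGraph V, IsForestDecomposition G k F}.Nonempty := by
    have : Finite G.edgeSet := Subtype.finite
    let e := Finite.equivFin G.edgeSet
    have key : ∀ i, (SimpleGraph.fromEdgeSet {((e.symm i : G.edgeSet) : Sym2 V)}).edgeSet
        = {((e.symm i : G.edgeSet) : Sym2 V)} := by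
      intro i
      rw [SimpleGraph.edgeSet_fromEdgeSet]
      ext x
      simp only [Set.mem_sdiff, Set.mem_singleton_iff]
      constructor
      · exact fun h => h.1
      · rintro rfl
        exact ⟨rfl, G.not_isDiag_of_mem_edgeSet (e.symm i).2⟩
    refine ⟨Nat.card G.edgeSet,
      fun i => SimpleGraph.fromEdgeSet {((e.symm i : G.edgeSet) : Sym2 V)}, ?_, ?_, ?_⟩
    · intro i v c hc
      have h3 := hc.three_le_length
      have hsub : ∀ x ∈ c.edges, x = ((e.symm i : G.edgeSet) : Sym2 V) := by
        intro x hx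
        have := c.edges_subset_edgeSet hx
        rw [key] at this
        exact this
      have hrep := List.eq_replicate_of_mem hsub
      have hnd := hc.edges_nodup
      rw [hrep, List.nodup_replicate, SimpleGraph.Walk.length_edges] at hnd
      omega
    · intro i j hij
      rw [key, key, Set.disjoint_singleton]
      intro h
      exact hij (e.symm.injective (Subtype.ext h))
    · ext x
      simp only [Set.mem_iUnion, key, Set.mem_singleton_iff]
      constructor
      · rintro ⟨i, rfl⟩
        exact (e.symm i).2
      · intro hx
        exact ⟨e ⟨x, hx⟩, by rw [e.symm_apply_apply]⟩
  exact Nat.sInf_mem hne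

/-- A network on the `n`-vertex graph `G`: the vertices carry distinct identity numbers from
`{1, …, n}`, and each vertex numbers its incident edges arbitrarily (`ports v` lists the
neighbours of `v` in the order of the port numbers `0, 1, …, deg v - 1`). -/
structure Network {V : Type*} [Fintype V] (G : SimpleGraph V) where
  id : V → ℕ
  id_injective : Function.Injective id
  one_le_id : ∀ v, 1 ≤ id v
  id_le : ∀ v, id v ≤ Fintype.card V
  ports : V → List V
  ports_nodup : ∀ v, (ports v).Nodup
  mem_ports : ∀ v u, u ∈ ports v ↔ G.Adj v u

/-- A deterministic distributed algorithm in the synchronous message passing model, with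
unrestricted local computation and message size. -/
structure DistributedAlgorithm where
  State : Type
  Msg : Type
  /-- The initial state of a vertex, from the global parameters `n` and `a` and its own
  identity number. -/
  init : (n a idNumber : ℕ) → State
  /-- The message (if any) that a vertex in the given state sends over the given port. -/
  send : State → (port : ℕ) → Option Msg
  /-- The new state, from the old one and what has arrived over the ports, in port order. -/
  receive : State → List (Option Msg) → State
  /-- `some c` means that the vertex has terminated with the final colour `c`. -/
  output : State → Option ℕ

namespace DistributedAlgorithm

variable {V : Type*} [Fintype V] [DecidableEq V] {G : SimpleGraph V}

/-- What a vertex in state `s` emits over a port: a terminated vertex is silent. -/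
def emit (A : DistributedAlgorithm) (s : A.State) (port : ℕ) : Option A.Msg :=
  if (A.output s).isSome then none else A.send s port

/-- The state of each vertex after `t` synchronous rounds. In a round every vertex receives what
each neighbour emitted over their common edge; a terminated vertex keeps its state. -/
def stateAfter (A : DistributedAlgorithm) (a : ℕ) (N : Network G) : ℕ → V → A.State
  | 0, v => A.init (Fintype.card V) a (N.id v)
  | t + 1, v =>
    if (A.output (A.stateAfter a N t v)).isSome then A.stateAfter a N t v
    else A.receive (A.stateAfter a N t v)
      ((N.ports v).map fun u => A.emit (A.stateAfter a N t u) ((N.ports u).idxOf v))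

/-- On the network `N`, with the parameter `a`, all vertices terminate within `T` rounds, and
their final colours form `φ`. -/
def ComputesWithin (A : DistributedAlgorithm) (a : ℕ) (N : Network G) (T : ℕ) (φ : V → ℕ) :
    Prop :=
  ∀ v, A.output (A.stateAfter a N T v) = some (φ v)

end DistributedAlgorithm

/-- `φ` is a legal colouring of `G` with the palette `{1, …, k}`. -/
def IsLegalColoring {V : Type*} (G : SimpleGraph V) (k : ℕ) (φ : V → ℕ) : Prop :=
  (∀ v, φ v ∈ Finset.Icc 1 k) ∧ ∀ u v, G.Adj u v → φ u ≠ φ v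

/-! Arboricity enters only through sparsity: every vertex set S spans at most a|S| edges
(`isSparse_of_arboricity_le`). Being d-sparse passes to subgraphs, so removing vertices with at most
4d remaining neighbours halves the rest, and O(log n) levels suffice (`exists_levels`).

The core is one split of a d-sparse graph into k colour classes (`exists_split`). Within a level
degrees are at most 4d, and polynomial codes give in two rounds a colouring with O(κ²) colours and
defect 2⌊4d/κ⌋. Level and colour together rank the vertices; in rank order each takes the colour
least used by its at most 4d lower-ranked neighbours. By `isSparse_of_rank` every class is (⌊4d/k⌋ +
⌊4d/κ⌋)-sparse.

With k = ⌊a^(1/r)⌋ and κ ≥ k, r nested splits use k^r ≤ a colours and leave sparsity below 16^r. A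
last split into 4·16^r + 1 classes makes both quotients 0, so no monochromatic edge survives. The
cost is O(L(a^(2/r) + L^(2/r))) rounds with L = ⌊log₂ n⌋ + 1, and a large r gives the bound.

The procedures are written as functions of the whole labelled graph satisfying `IsLocal`; one
full-information protocol executes any such function. -/

/-! ### Locality: functions of a graph computable in t rounds -/

section Locality

variable {V α β γ : Type*}

/-- `G` and `G'` look the same to the vertex `v` after `t` rounds of full-information exchange. -/
def AgreeNear : ℕ → SimpleGraph V → SimpleGraph V → V → Prop
  | 0, _, _, _ => True
  | t + 1, G, G', v => AgreeNear t G G' v ∧ (∀ u, G.Adj v u ↔ G'.Adj v u) ∧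
      ∀ u, G.Adj v u → AgreeNear t G G' u

theorem AgreeNear.refl (t : ℕ) (G : SimpleGraph V) (v : V) : AgreeNear t G G v := by
  induction t generalizing v with
  | zero => trivial
  | succ t ih => exact ⟨ih v, fun _ => Iff.rfl, fun u _ => ih u⟩

theorem AgreeNear.mono {s t : ℕ} (h : s ≤ t) {G G' : SimpleGraph V} {v : V}
    (H : AgreeNear t G G' v) : AgreeNear s G G' v := by
  induction t, h using Nat.le_induction with
  | base => exact H
  | succ t _ ih => exact ih H.1

/-- The value of `F` at a vertex can be computed by that vertex in `t` rounds. -/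
def IsLocal (t : ℕ) (F : SimpleGraph V → V → α) : Prop :=
  ∀ G G' v, AgreeNear t G G' v → F G v = F G' v

namespace IsLocal

theorem mono {s t : ℕ} {F : SimpleGraph V → V → α} (hF : IsLocal s F) (h : s ≤ t) :
    IsLocal t F := fun G G' v H => hF G G' v (H.mono h)

theorem of_vertex (f : V → α) : IsLocal 0 (fun (_ : SimpleGraph V) v => f v) :=
  fun _ _ _ _ => rfl

theorem map₂ {t : ℕ} {F : SimpleGraph V → V → α} {F' : SimpleGraph V → V → β}
    (g : α → β → γ) (hF : IsLocal t F) (hF' : IsLocal t F') :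
    IsLocal t (fun G v => g (F G v) (F' G v)) := fun G G' v H => by
  simp only [hF G G' v H, hF' G G' v H]

/-- One communication round: each vertex learns the value of `F` at its neighbours. -/
theorem step {t : ℕ} {F : SimpleGraph V → V → α} {H : SimpleGraph V → V → β} (hF : IsLocal t F)
    (h : ∀ G G' v, (∀ u, G.Adj v u ↔ G'.Adj v u) → F G v = F G' v →
      (∀ u, G.Adj v u → F G u = F G' u) → H G v = H G' v) : IsLocal (t + 1) H :=
  fun G G' v hA => h G G' v hA.2.1 (hF G G' v hA.1) fun u hu => hF G G' u (hA.2.2 u hu)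

end IsLocal

/-- The edges of `G` both of whose ends have the same colour. -/
def monochromatic (G : SimpleGraph V) (c : V → α) : SimpleGraph V where
  Adj u v := G.Adj u v ∧ c u = c v
  symm := ⟨fun _ _ h => ⟨h.1.symm, h.2.symm⟩⟩
  loopless := ⟨fun _ h => h.1.ne rfl⟩

theorem monochromatic_adj {G : SimpleGraph V} {c : V → α} {u v : V} :
    (monochromatic G c).Adj u v ↔ G.Adj u v ∧ c u = c v := Iff.rfl

theorem AgreeNear.monochromatic {t : ℕ} {c : SimpleGraph V → V → α} (hc : IsLocal t c)
    {s : ℕ} {G G' : SimpleGraph V} {v : V} (h : AgreeNear (t + s) G G' v) :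
    AgreeNear s (monochromatic G (c G)) (monochromatic G' (c G')) v := by
  induction s generalizing v with
  | zero => trivial
  | succ s ih =>
    replace h : AgreeNear ((t + s) + 1) G G' v := h
    refine ⟨ih h.1, fun u => ?_, fun u hu => ih (h.2.2 u hu.1)⟩
    have hv := hc G G' v (h.mono (by omega))
    simp only [monochromatic_adj]
    constructor
    · rintro ⟨h1, h2⟩
      exact ⟨(h.2.1 u).1 h1, by
        rw [← hv, ← hc G G' u ((h.2.2 u h1).mono (by omega)), h2]⟩
    · rintro ⟨h1, h2⟩
      have h1 := (h.2.1 u).2 h1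
      exact ⟨h1, by rw [hv, hc G G' u ((h.2.2 u h1).mono (by omega)), h2]⟩

/-- Running a procedure on all colour classes in parallel: once the colours are known, each vertex
can tell which of its edges are monochromatic. -/
theorem IsLocal.comp_monochromatic {t s : ℕ} {c : SimpleGraph V → V → α}
    {F : SimpleGraph V → V → β} (hc : IsLocal t c) (hF : IsLocal s F) :
    IsLocal (t + s) (fun G => F (monochromatic G (c G))) :=
  fun _ _ _ h => hF _ _ _ (h.monochromatic hc)

theorem AgreeNear.comap {W : Type*} (f : W → V) {t : ℕ} {G G' : SimpleGraph V} {w : W}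
    (h : AgreeNear t G G' (f w)) : AgreeNear t (G.comap f) (G'.comap f) w := by
  induction t generalizing w with
  | zero => trivial
  | succ t ih => exact ⟨ih h.1, fun u => h.2.1 (f u), fun u hu => ih (h.2.2 (f u) hu)⟩

end Locality

/-! ### Sparsity from forests and from rankings -/

section Counting

open scoped Classical
open Finset

variable {V : Type*}

/-- Every set `S` of vertices spans at most `d * |S|` edges. -/
def IsSparse (d : ℕ) (G : SimpleGraph V) : Prop :=
  ∀ S : Finset V, ∑ v ∈ S, #{u ∈ S | G.Adj v u} ≤ 2 * d * #S

theorem IsSparse.mono {d d' : ℕ} (h : d ≤ d') {G : SimpleGraph V} (hG : IsSparse d G) :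
    IsSparse d' G := fun S => (hG S).trans (by gcongr)

theorem IsSparse.not_adj [Fintype V] {G : SimpleGraph V} (hG : IsSparse 0 G) (u v : V) : ¬ G.Adj u v := by
  intro h
  have h0 := hG univ
  simp only [mul_zero, zero_mul, nonpos_iff_eq_zero, sum_eq_zero_iff] at h0
  have := h0 u (mem_univ u)
  rw [card_eq_zero, filter_eq_empty_iff] at this
  exact this (mem_univ v) h

/-- The forest induced on a nonempty S extends to a spanning tree of the complete graph on S, which
has |S| - 1 edges. -/
theorem isSparse_of_isAcyclic [Fintype V] {F : SimpleGraph V} (hF : F.IsAcyclic) : IsSparse 1 F := by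
  intro S
  rcases S.eq_empty_or_nonempty with rfl | hS
  · simp
  have hne : Nonempty S := hS.to_subtype
  set H : SimpleGraph S := F.comap (Subtype.val : S → V) with hH
  have hac : H.IsAcyclic := hF.of_comap ⟨_, Subtype.val_injective⟩
  obtain ⟨T, hHT, -, hT⟩ :=
    (SimpleGraph.connected_top (V := S)).exists_isTree_le_of_le_of_isAcyclic le_top hac
  have h1 := hT.card_edgeFinset
  have h2 : #H.edgeFinset ≤ #T.edgeFinset := card_le_card (SimpleGraph.edgeFinset_mono hHT)
  have h3 := H.sum_degrees_eq_twice_card_edges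
  rw [Fintype.card_coe] at h1
  have h4 : ∑ v ∈ S, #{u ∈ S | F.Adj v u} = ∑ v : S, H.degree v := by
    rw [← sum_coe_sort]
    refine sum_congr rfl fun v _ => ?_
    rw [← SimpleGraph.card_neighborFinset_eq_degree, ← card_map ⟨_, Subtype.val_injective⟩]
    congr 1
    ext u
    simp [hH, and_comm]
  rw [h4, h3]
  omega

theorem isSparse_of_arboricity_le [Fintype V] {G : SimpleGraph V} {a : ℕ} (h : arboricity G ≤ a) :
    IsSparse a G := by
  refine IsSparse.mono h fun S => ?_
  obtain ⟨F, hF, -, hE⟩ := exists_isForestDecomposition_arboricity G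
  have key : ∀ v ∈ S, #{u ∈ S | G.Adj v u} ≤ ∑ i, #{u ∈ S | (F i).Adj v u} := by
    intro v _
    refine (card_le_card ?_).trans card_biUnion_le
    intro u hu
    rw [mem_filter] at hu
    have : s(v, u) ∈ ⋃ i, (F i).edgeSet := by rw [hE]; exact hu.2
    obtain ⟨i, hi⟩ := Set.mem_iUnion.1 this
    exact mem_biUnion.2 ⟨i, mem_univ i, mem_filter.2 ⟨hu.1, hi⟩⟩
  calc ∑ v ∈ S, #{u ∈ S | G.Adj v u}
      ≤ ∑ v ∈ S, ∑ i, #{u ∈ S | (F i).Adj v u} := sum_le_sum key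
    _ = ∑ i, ∑ v ∈ S, #{u ∈ S | (F i).Adj v u} := sum_comm
    _ ≤ ∑ _i : Fin (arboricity G), 2 * 1 * #S :=
        sum_le_sum fun i _ => isSparse_of_isAcyclic (hF i) S
    _ = 2 * arboricity G * #S := by simp; ring

theorem IsSparse.comap_equiv {W : Type*} (e : W ≃ V) {d : ℕ} {G : SimpleGraph V}
    (hG : IsSparse d G) : IsSparse d (G.comap e) := by
  intro S
  have h := hG (S.map e.toEmbedding)
  rw [sum_map, card_map] at h
  refine le_trans (le_of_eq (sum_congr rfl fun v _ => ?_)) h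
  rw [← card_map e.toEmbedding]
  congr 1
  ext u
  simp only [mem_map, mem_filter, SimpleGraph.comap_adj]
  constructor
  · rintro ⟨x, ⟨h1, h2⟩, rfl⟩
    exact ⟨⟨x, h1, rfl⟩, h2⟩
  · rintro ⟨⟨x, h1, rfl⟩, h2⟩
    exact ⟨x, ⟨h1, h2⟩, rfl⟩

/-- If every vertex has at most `x` neighbours of smaller rank and at most `2 * y` neighbours of
equal rank, then the graph is sparse. -/
theorem isSparse_of_rank [Fintype V] {G : SimpleGraph V} (s : V → ℕ) {x y : ℕ}
    (hx : ∀ v, #{u | G.Adj v u ∧ s u < s v} ≤ x)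
    (hy : ∀ v, #{u | G.Adj v u ∧ s u = s v} ≤ 2 * y) : IsSparse (x + y) G := by
  intro S
  have hlow : ∑ v ∈ S, #{u ∈ S | G.Adj v u ∧ s u < s v} ≤ #S * x := by
    rw [← smul_eq_mul]
    refine sum_le_card_nsmul _ _ _ fun v _ => le_trans (card_le_card ?_) (hx v)
    exact filter_subset_filter _ (subset_univ _)
  have hsame : ∑ v ∈ S, #{u ∈ S | G.Adj v u ∧ s u = s v} ≤ #S * (2 * y) := by
    rw [← smul_eq_mul]
    refine sum_le_card_nsmul _ _ _ fun v _ => le_trans (card_le_card ?_) (hy v)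
    exact filter_subset_filter _ (subset_univ _)
  -- An edge going up from one end goes down from the other, so the bound on lower-ranked neighbours
  -- also pays for the higher-ranked ones.
  have hhigh : ∑ v ∈ S, #{u ∈ S | G.Adj v u ∧ s v < s u}
      = ∑ v ∈ S, #{u ∈ S | G.Adj v u ∧ s u < s v} := by
    simp only [card_filter]
    rw [sum_comm]
    simp only [G.adj_comm]
  have hsplit : ∀ v ∈ S, #{u ∈ S | G.Adj v u} ≤ #{u ∈ S | G.Adj v u ∧ s u < s v} +
      #{u ∈ S | G.Adj v u ∧ s u = s v} + #{u ∈ S | G.Adj v u ∧ s v < s u} := by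
    intro v _
    refine (card_le_card ?_).trans ((card_union_le _ _).trans
      (Nat.add_le_add_right (card_union_le _ _) _))
    intro u hu
    simp only [mem_union, mem_filter] at hu ⊢
    rcases lt_trichotomy (s u) (s v) with h | h | h <;> simp [hu, h]
  have := sum_le_sum hsplit
  rw [sum_add_distrib, sum_add_distrib, hhigh] at this
  nlinarith

end Counting

/-! ### Peeling a sparse graph into levels -/

section Levels

open scoped Classical
open Finset

variable {V : Type*} [Fintype V]

/-- The vertices left after `j` rounds in each of which every vertex with at most `A` remaining
neighbours is removed. -/
def Survives (A : ℕ) (G : SimpleGraph V) : ℕ → V → Prop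
  | 0, _ => True
  | j + 1, v => Survives A G j v ∧ A < #{u | G.Adj v u ∧ Survives A G j u}

theorem Survives.anti {A : ℕ} {G : SimpleGraph V} {i j : ℕ} (h : i ≤ j) {v : V}
    (H : Survives A G j v) : Survives A G i v := by
  induction j, h using Nat.le_induction with
  | base => exact H
  | succ j _ ih => exact ih H.1

theorem isLocal_survives (A j : ℕ) :
    IsLocal j (fun (G : SimpleGraph V) v => Survives A G j v) := by
  induction j with
  | zero => exact fun _ _ _ _ => rfl
  | succ j ih =>
    refine ih.step fun G G' v hadj hv hu => ?_
    have : ∀ u, (G.Adj v u ∧ Survives A G j u) ↔ (G'.Adj v u ∧ Survives A G' j u) := by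
      intro u
      rw [← hadj u]
      exact and_congr_right fun h => iff_of_eq (hu u h)
    simp only [Survives, this]
    rw [hv]

/-- Each vertex surviving the next round has more than 4d neighbours among the current survivors S,
whose degrees within S sum to at most 2d|S|. -/
theorem card_survives_succ {d : ℕ} {G : SimpleGraph V} (hG : IsSparse d G) (j : ℕ) :
    2 * #{v | Survives (4 * d) G (j + 1) v} ≤ #{v | Survives (4 * d) G j v} := by
  set S : Finset V := {v | Survives (4 * d) G j v} with hS
  set S' : Finset V := {v | Survives (4 * d) G (j + 1) v} with hS'
  have hsub : S' ⊆ S := by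
    intro v hv
    rw [hS', mem_filter] at hv
    exact mem_filter.2 ⟨mem_univ v, hv.2.1⟩
  have h1 : #S' * (4 * d + 1) ≤ ∑ v ∈ S', #{u ∈ S | G.Adj v u} := by
    rw [← smul_eq_mul]
    refine card_nsmul_le_sum _ _ _ fun v hv => ?_
    rw [hS', mem_filter] at hv
    refine hv.2.2.trans_le (card_le_card fun u hu => ?_)
    rw [mem_filter] at hu
    exact mem_filter.2 ⟨mem_filter.2 ⟨mem_univ u, hu.2.2⟩, hu.2.1⟩
  have h2 : ∑ v ∈ S', #{u ∈ S | G.Adj v u} ≤ ∑ v ∈ S, #{u ∈ S | G.Adj v u} :=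
    sum_le_sum_of_subset hsub
  have h3 := hG S
  have h4 : #S' ≤ #S := card_le_card hsub
  by_contra! h
  nlinarith

theorem not_survives {d ℓ : ℕ} (hℓ : Fintype.card V < 2 ^ ℓ) {G : SimpleGraph V}
    (hG : IsSparse d G) (v : V) : ¬ Survives (4 * d) G ℓ v := by
  have key : ∀ j, 2 ^ j * #{v | Survives (4 * d) G j v} ≤ Fintype.card V := by
    intro j
    induction j with
    | zero => simpa using card_le_univ _
    | succ j ih =>
      have := Nat.mul_le_mul_left (2 ^ j) (card_survives_succ hG j)
      calc _ = 2 ^ j * (2 * #{v | Survives (4 * d) G (j + 1) v}) := by ring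
        _ ≤ _ := this.trans ih
  intro hv
  have : 1 ≤ #{v | Survives (4 * d) G ℓ v} := card_pos.2 ⟨v, by simpa using hv⟩
  have := Nat.mul_le_mul_left (2 ^ ℓ) this
  have := key ℓ
  omega

theorem isLocal_findGreatest {V : Type*} {P : SimpleGraph V → ℕ → V → Prop}
    (hP : ∀ j, IsLocal j (fun G => P G j)) (ℓ : ℕ) :
    IsLocal ℓ (fun G v => Nat.findGreatest (fun j => P G j v) ℓ) := by
  induction ℓ with
  | zero => exact fun _ _ _ _ => rfl
  | succ ℓ ih =>
    have := IsLocal.map₂ (fun p x => if p then ℓ + 1 else x) (hP (ℓ + 1)) (ih.mono (Nat.le_succ ℓ))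
    simpa only [Nat.findGreatest_succ] using this

/-- A sparse graph is partitioned into logarithmically many levels, such that every vertex has few
neighbours on its own and higher levels. -/
theorem exists_levels (V : Type*) [Fintype V] (d ℓ : ℕ) (hℓ : Fintype.card V < 2 ^ ℓ) :
    ∃ lev : SimpleGraph V → V → ℕ, IsLocal ℓ lev ∧ ∀ G, IsSparse d G → ∀ v,
      lev G v < ℓ ∧ #{u | G.Adj v u ∧ lev G v ≤ lev G u} ≤ 4 * d := by
  refine ⟨fun G v => Nat.findGreatest (fun j => Survives (4 * d) G j v) ℓ,
    isLocal_findGreatest (isLocal_survives (4 * d)) ℓ, fun G hG v => ?_⟩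
  have hspec : ∀ w, Survives (4 * d) G (Nat.findGreatest (fun j => Survives (4 * d) G j w) ℓ) w :=
    fun w => Nat.findGreatest_spec (P := fun j => Survives (4 * d) G j w) (Nat.zero_le ℓ) trivial
  have hlt : Nat.findGreatest (fun j => Survives (4 * d) G j v) ℓ < ℓ := by
    refine lt_of_le_of_ne (Nat.findGreatest_le ℓ) fun h => not_survives hℓ hG v ?_
    have := hspec v
    rwa [h] at this
  refine ⟨hlt, ?_⟩
  -- The level is the last index survived; failing the next one bounds the neighbours that survive
  -- at least as long.
  have hn : ¬ Survives (4 * d) G (Nat.findGreatest (fun j => Survives (4 * d) G j v) ℓ + 1) v :=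
    Nat.findGreatest_is_greatest (P := fun j => Survives (4 * d) G j v) (Nat.lt_succ_self _) hlt
  have := fun h => hn ⟨hspec v, h⟩
  refine le_trans (card_le_card fun u hu => ?_) (not_lt.1 this)
  rw [mem_filter] at hu ⊢
  exact ⟨hu.1, hu.2.1, (hspec u).anti hu.2.2⟩

end Levels

/-! ### Polynomial codes -/

section Codes

open Finset Polynomial

/-- Evaluations of polynomials of degree at most `D` over a field with `q` elements. -/
theorem exists_code {q D M : ℕ} (hq : q.Prime) (hM : M ≤ q ^ (D + 1)) :
    ∃ f : ℕ → ℕ → ℕ, (∀ c x, f c x < q) ∧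
      ∀ c < M, ∀ c' < M, c ≠ c' → #{x ∈ range q | f c x = f c' x} ≤ D := by
  have : Fact q.Prime := ⟨hq⟩
  obtain ⟨e⟩ : Nonempty (Fin M ↪ (Fin (D + 1) → ZMod q)) :=
    Function.Embedding.nonempty_of_card_le (by simpa [ZMod.card] using hM)
  let p : Fin M → (ZMod q)[X] := fun c => ((degreeLTEquiv (ZMod q) (D + 1)).symm (e c)).1
  have hp : Function.Injective p := fun c c' h =>
    e.injective ((degreeLTEquiv (ZMod q) (D + 1)).symm.injective (Subtype.ext h))
  have hdeg : ∀ c c', (p c - p c').natDegree ≤ D := fun c c' =>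
    natDegree_le_of_degree_le <| Order.lt_succ_iff.1 <| mem_degreeLT.1 <|
      Submodule.sub_mem _ ((degreeLTEquiv (ZMod q) (D + 1)).symm (e c)).2
        ((degreeLTEquiv (ZMod q) (D + 1)).symm (e c')).2
  refine ⟨fun c x => if h : c < M then ((p ⟨c, h⟩).eval (x : ZMod q)).val else 0, ?_, ?_⟩
  · intro c x
    dsimp only
    split_ifs
    · exact ZMod.val_lt _
    · exact hq.pos
  · intro c hc c' hc' hne
    have hr : p ⟨c, hc⟩ - p ⟨c', hc'⟩ ≠ 0 := fun h =>
      hne (congrArg Fin.val (hp (sub_eq_zero.1 h)))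
    refine le_trans ?_ (((Multiset.toFinset_card_le _).trans (card_roots' _)).trans
      (hdeg ⟨c, hc⟩ ⟨c', hc'⟩))
    refine card_le_card_of_injOn (fun x => (x : ZMod q)) ?_ ?_
    · intro x hx
      simp only [coe_filter, mem_range, Set.mem_ofPred_eq, hc, hc', dif_pos] at hx
      have := ZMod.val_injective q hx.2
      simp [hr, this]
    · intro x hx y hy hxy
      simp only [coe_filter, mem_range, Set.mem_ofPred_eq] at hx hy
      have := (ZMod.natCast_eq_natCast_iff' x y q).1 hxy
      rwa [Nat.mod_eq_of_lt hx.1, Nat.mod_eq_of_lt hy.1] at this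

end Codes

/-! ### Defective colourings and the ranked greedy choice -/

section Rounds

open scoped Classical
open Finset

/-- Some argument has at most the average load. -/
theorem exists_light {k : ℕ} (hk : 0 < k) (h : ℕ → ℕ) :
    ∃ x < k, k * h x ≤ ∑ y ∈ range k, h y := by
  obtain ⟨x, hx, hmin⟩ := exists_min_image (range k) h ⟨0, mem_range.2 hk⟩
  refine ⟨x, mem_range.1 hx, ?_⟩
  simpa using card_nsmul_le_sum (range k) h (h x) hmin

/-- An argument below `k` with at most the average load. -/
noncomputable def light (k : ℕ) (h : ℕ → ℕ) : ℕ :=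
  if hk : 0 < k then (exists_light hk h).choose else 0

theorem light_lt {k : ℕ} (hk : 0 < k) (h : ℕ → ℕ) : light k h < k := by
  rw [light, dif_pos hk]
  exact (exists_light hk h).choose_spec.1

theorem mul_light_le {k : ℕ} (hk : 0 < k) (h : ℕ → ℕ) :
    k * h (light k h) ≤ ∑ y ∈ range k, h y := by
  rw [light, dif_pos hk]
  exact (exists_light hk h).choose_spec.2

variable {V : Type*} [Fintype V]

/-- One round that reduces the number of colours from `M` to `q * q` and increases the number of
neighbours of the same colour by at most `D * A / q`. -/
theorem exists_reduce_colors {A M q D t δ : ℕ} (hq : q.Prime) (hM : M ≤ q ^ (D + 1))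
    {c : SimpleGraph V → V → ℕ} (hc : IsLocal t c) (hcM : ∀ G v, c G v < M)
    (hδ : ∀ G, (∀ v, #{u | G.Adj v u} ≤ A) → ∀ v, #{u | G.Adj v u ∧ c G u = c G v} ≤ δ) :
    ∃ c' : SimpleGraph V → V → ℕ, IsLocal (t + 1) c' ∧ (∀ G v, c' G v < q * q) ∧
      ∀ G, (∀ v, #{u | G.Adj v u} ≤ A) →
        ∀ v, #{u | G.Adj v u ∧ c' G u = c' G v} ≤ δ + D * A / q := by
  obtain ⟨f, hfq, hf⟩ := exists_code hq hM
  let load : SimpleGraph V → V → ℕ → ℕ := fun G v x =>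
    #{u | G.Adj v u ∧ c G u ≠ c G v ∧ f (c G u) x = f (c G v) x}
  let X : SimpleGraph V → V → ℕ := fun G v => light q (load G v)
  have hX : ∀ G v, X G v < q := fun G v => light_lt hq.pos _
  -- The new colour encodes the pair (value, evaluation point). Two vertices sharing it used the
  -- same point, so only collisions at the vertex's own lightly loaded point matter.
  refine ⟨fun G v => f (c G v) (X G v) + q * X G v, ?_, ?_, ?_⟩
  · refine hc.step fun G G' v hadj hv hu => ?_
    have : load G v = load G' v := by
      funext x
      simp only [load]
      congr 1
      ext u
      simp only [mem_filter, mem_univ, true_and, ← hadj u, ← hv]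
      exact and_congr_right fun h => by rw [hu u h]
    simp only [X, this, hv]
  · intro G v
    have h1 := hfq (c G v) (X G v)
    have h2 : q * (X G v + 1) ≤ q * q := Nat.mul_le_mul_left q (hX G v)
    rw [mul_add] at h2
    dsimp only
    omega
  · intro G hG v
    have hsum : ∑ x ∈ range q, load G v x ≤ D * A := by
      simp only [load, card_filter]
      rw [sum_comm]
      calc _ ≤ ∑ u, if G.Adj v u then D else 0 := by
            refine sum_le_sum fun u _ => ?_
            by_cases h1 : G.Adj v u
            · by_cases h2 : c G u = c G v
              · simp [h2]
              · rw [if_pos h1, ← card_filter]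
                refine le_trans (card_le_card fun x hx => ?_)
                  (hf _ (hcM G u) _ (hcM G v) h2)
                rw [mem_filter] at hx ⊢
                exact ⟨hx.1, hx.2.2.2⟩
            · simp [h1]
        _ = #{u | G.Adj v u} * D := by rw [← sum_filter, sum_const, smul_eq_mul]
        _ ≤ D * A := by rw [mul_comm]; exact Nat.mul_le_mul_left D (hG v)
    have hload : load G v (X G v) ≤ D * A / q := by
      rw [Nat.le_div_iff_mul_le hq.pos, mul_comm]
      exact (mul_light_le hq.pos _).trans hsum
    refine le_trans ((card_le_card fun u hu => ?_).trans (card_union_le _ _))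
      (Nat.add_le_add (hδ G hG v) hload)
    simp only [mem_union, mem_filter, mem_univ, true_and] at hu ⊢
    obtain ⟨h1, h2⟩ := hu
    have hXX : X G u = X G v := by
      have := congrArg (· / q) h2
      simpa [Nat.add_mul_div_left _ _ hq.pos, Nat.div_eq_of_lt (hfq _ _)] using this
    rw [hXX] at h2
    by_cases h3 : c G u = c G v
    · exact Or.inl ⟨h1, h3⟩
    · exact Or.inr ⟨h1, h3, Nat.add_right_cancel h2⟩

/-- A colouring, computed in two rounds, in which the vertices of a graph of maximum degree `A`
have few neighbours of their own colour. -/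
theorem exists_defective_coloring {n : ℕ} (A q₁ q₂ D₁ D₂ κ : ℕ) (hq₁ : q₁.Prime)
    (hq₂ : q₂.Prime) (hn : n ≤ q₁ ^ (D₁ + 1)) (hq : q₁ * q₁ ≤ q₂ ^ (D₂ + 1))
    (hD₁ : 0 < D₁) (hD₂ : 0 < D₂) (h₁ : D₁ * κ ≤ q₁) (h₂ : D₂ * κ ≤ q₂) (hκ : 0 < κ) :
    ∃ c : SimpleGraph (Fin n) → Fin n → ℕ, IsLocal 2 c ∧ (∀ G v, c G v < q₂ * q₂) ∧
      ∀ G, (∀ v, #{u | G.Adj v u} ≤ A) →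
        ∀ v, #{u | G.Adj v u ∧ c G u = c G v} ≤ 2 * (A / κ) := by
  have hdiv : ∀ {D q : ℕ}, 0 < D → D * κ ≤ q → D * A / q ≤ A / κ := by
    intro D q hD h
    calc D * A / q ≤ D * A / (D * κ) := Nat.div_le_div_left h (Nat.mul_pos hD hκ)
      _ = A / κ := Nat.mul_div_mul_left _ _ hD
  -- The initial colours are the vertices themselves, hence defect 0.
  obtain ⟨c₁, hl₁, hlt₁, hd₁⟩ := exists_reduce_colors (A := A) (δ := 0) hq₁ hn
    (IsLocal.of_vertex (fun v : Fin n => (v : ℕ))) (fun _ v => v.2) (by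
      intro G _ v
      rw [nonpos_iff_eq_zero, card_eq_zero, filter_eq_empty_iff]
      rintro u - ⟨h, h'⟩
      exact h.ne (Fin.ext h'.symm))
  obtain ⟨c₂, hl₂, hlt₂, hd₂⟩ := exists_reduce_colors hq₂ hq hl₁ hlt₁ hd₁
  refine ⟨c₂, hl₂, hlt₂, fun G hG v => (hd₂ G hG v).trans ?_⟩
  have := hdiv hD₁ h₁
  have := hdiv hD₂ h₂
  omega

/-- In round `j` the vertices of rank `j` choose, among `k` colours, one that is least used by
their neighbours of smaller rank. -/
noncomputable def greedyColor (k : ℕ) (s : SimpleGraph V → V → ℕ) :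
    ℕ → SimpleGraph V → V → ℕ
  | 0, _, _ => 0
  | j + 1, G, v =>
    if s G v = j then light k fun x => #{u | G.Adj v u ∧ s G u < j ∧ greedyColor k s j G u = x}
    else greedyColor k s j G v

theorem isLocal_greedyColor (k : ℕ) {s : SimpleGraph V → V → ℕ} {t : ℕ} (hs : IsLocal t s)
    (j : ℕ) : IsLocal (t + j) (greedyColor k s j) := by
  induction j with
  | zero => exact fun _ _ _ _ => rfl
  | succ j ih =>
    have hpair := IsLocal.map₂ Prod.mk (hs.mono (Nat.le_add_right t j)) ih
    refine hpair.step fun G G' v hadj hv hu => ?_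
    simp only [Prod.mk.injEq] at hv hu
    have : (fun x => #{u | G.Adj v u ∧ s G u < j ∧ greedyColor k s j G u = x})
        = fun x => #{u | G'.Adj v u ∧ s G' u < j ∧ greedyColor k s j G' u = x} := by
      funext x
      congr 1
      ext u
      simp only [mem_filter, mem_univ, true_and, ← hadj u]
      exact and_congr_right fun h => by rw [(hu u h).1, (hu u h).2]
    simp only [greedyColor, this, hv]

theorem greedyColor_lt {k : ℕ} (hk : 0 < k) (s : SimpleGraph V → V → ℕ) (j : ℕ)
    (G : SimpleGraph V) (v : V) : greedyColor k s j G v < k := by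
  induction j with
  | zero => exact hk
  | succ j ih =>
    rw [greedyColor]
    split_ifs
    · exact light_lt hk _
    · exact ih

theorem greedyColor_eq (k : ℕ) (s : SimpleGraph V → V → ℕ) {i j : ℕ} (h : i ≤ j)
    {G : SimpleGraph V} {v : V} (hv : s G v < i) : greedyColor k s j G v = greedyColor k s i G v := by
  induction j, h using Nat.le_induction with
  | base => rfl
  | succ j hj ih => rw [greedyColor, if_neg (by omega), ih]

/-- Pigeonhole: when a vertex chooses, its lower-ranked neighbours already have their final colours.
-/
theorem card_greedyColor_le {k : ℕ} (hk : 0 < k) (s : SimpleGraph V → V → ℕ) {m : ℕ}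
    {G : SimpleGraph V} {v : V} (hv : s G v < m) :
    #{u | G.Adj v u ∧ s G u < s G v ∧ greedyColor k s m G u = greedyColor k s m G v}
      ≤ #{u | G.Adj v u ∧ s G u < s G v} / k := by
  set load : ℕ → ℕ := fun x =>
    #{u | G.Adj v u ∧ s G u < s G v ∧ greedyColor k s m G u = x} with hload
  have hval : greedyColor k s m G v = light k load := by
    rw [greedyColor_eq k s hv (Nat.lt_succ_self _), greedyColor, if_pos rfl]
    congr 1
    funext x
    rw [hload]
    dsimp only
    congr 1
    ext u
    simp only [mem_filter, mem_univ, true_and]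
    refine and_congr_right fun _ => and_congr_right fun h => ?_
    rw [greedyColor_eq k s hv.le h]
  rw [Nat.le_div_iff_mul_le hk, mul_comm]
  change k * load (greedyColor k s m G v) ≤ _
  rw [hval]
  refine (mul_light_le hk load).trans (le_of_eq ?_)
  rw [card_eq_sum_card_fiberwise (f := greedyColor k s m G) (t := range k)
    (fun u _ => mem_coe.2 (mem_range.2 (greedyColor_lt hk s m G u)))]
  simp only [hload, filter_filter, and_assoc]

end Rounds

/-! ### Splitting into sparse classes, and iterating -/

section Splitting

open scoped Classical
open Finset

/-- A local colouring with `k` colours that reduces the sparsity by a factor of about `k / 8`. -/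
theorem exists_split {n ℓ q₁ q₂ D₁ D₂ κ : ℕ} (hℓ : n < 2 ^ ℓ) (hq₁ : q₁.Prime)
    (hq₂ : q₂.Prime) (hn : n ≤ q₁ ^ (D₁ + 1)) (hq : q₁ * q₁ ≤ q₂ ^ (D₂ + 1))
    (hD₁ : 0 < D₁) (hD₂ : 0 < D₂) (h₁ : D₁ * κ ≤ q₁) (h₂ : D₂ * κ ≤ q₂) (hκ : 0 < κ)
    (d k : ℕ) (hk : 0 < k) :
    ∃ g : SimpleGraph (Fin n) → Fin n → ℕ, IsLocal (ℓ + 2 + ℓ * (q₂ * q₂)) g ∧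
      (∀ G v, g G v < k) ∧
      ∀ G, IsSparse d G → IsSparse (4 * d / k + 4 * d / κ) (monochromatic G (g G)) := by
  obtain ⟨lev, hlev, hlevel⟩ := exists_levels (Fin n) d ℓ (by simpa using hℓ)
  obtain ⟨c₀, hc₀, hlt, hdef⟩ :=
    exists_defective_coloring (n := n) (4 * d) q₁ q₂ D₁ D₂ κ hq₁ hq₂ hn hq hD₁ hD₂ h₁ h₂ hκ
  set Q := q₂ * q₂ with hQ
  let c : SimpleGraph (Fin n) → Fin n → ℕ := fun G => c₀ (monochromatic G (lev G))
  have hc : IsLocal (ℓ + 2) c := hlev.comp_monochromatic hc₀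
  have hcQ : ∀ G v, c G v < Q := fun G v => hlt _ v
  -- Levels are reversed so that high levels choose first; a lower-ranked neighbour is then on the
  -- same or a higher level, and there are at most 4d of these.
  let s : SimpleGraph (Fin n) → Fin n → ℕ := fun G v => (ℓ - 1 - lev G v) * Q + c G v
  have hs : IsLocal (ℓ + 2) s :=
    IsLocal.map₂ (fun x y => (ℓ - 1 - x) * Q + y) (hlev.mono (Nat.le_add_right ℓ 2)) hc
  refine ⟨greedyColor k s (ℓ * Q), isLocal_greedyColor k hs _, fun G v => greedyColor_lt hk s _ G v,
    fun G hG => ?_⟩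
  have hl := hlevel G hG
  have hsm : ∀ v, s G v < ℓ * Q := by
    intro v
    have h1 := (hl v).1
    calc s G v < (ℓ - 1 - lev G v + 1) * Q := by
          rw [Nat.succ_mul]; exact Nat.add_lt_add_left (hcQ G v) _
      _ ≤ ℓ * Q := Nat.mul_le_mul_right Q (by omega)
  have hlow : ∀ u v, s G u < s G v → lev G v ≤ lev G u := by
    intro u v h
    by_contra! hlt'
    have h1 := (hl v).1
    have : (ℓ - 1 - lev G v + 1) * Q ≤ (ℓ - 1 - lev G u) * Q :=
      Nat.mul_le_mul_right Q (by omega)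
    have h2 := hcQ G v
    rw [Nat.succ_mul] at this
    simp only [s] at h
    omega
  have hsame : ∀ u v, s G u = s G v → lev G u = lev G v ∧ c G u = c G v := by
    intro u v h
    have hQ0 : 0 < Q := (Nat.zero_le _).trans_lt (hcQ G v)
    have hd : ℓ - 1 - lev G u = ℓ - 1 - lev G v := by
      have := congrArg (· / Q) h
      simpa [s, Nat.mul_comm _ Q, Nat.mul_add_div hQ0, Nat.div_eq_of_lt (hcQ _ _)] using this
    have h1 := (hl v).1
    have h2 := (hl u).1
    refine ⟨by omega, ?_⟩
    simp only [s, hd] at h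
    exact Nat.add_left_cancel h
  refine isSparse_of_rank (s G) (fun v => ?_) (fun v => ?_)
  · refine le_trans (le_of_eq ?_) ((card_greedyColor_le hk s (hsm v)).trans
      (Nat.div_le_div_right ((card_le_card ?_).trans (hl v).2)))
    · congr 1
      ext u
      simp only [mem_filter, mem_univ, true_and, monochromatic_adj]
      constructor
      · rintro ⟨⟨h1, h2⟩, h3⟩
        exact ⟨h1, h3, h2.symm⟩
      · rintro ⟨h1, h3, h2⟩
        exact ⟨⟨h1, h2.symm⟩, h3⟩
    · intro u hu
      simp only [mem_filter, mem_univ, true_and] at hu ⊢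
      exact ⟨hu.1, hlow u v hu.2⟩
  · refine (card_le_card fun u hu => ?_).trans
      (hdef (monochromatic G (lev G)) (fun w => (card_le_card fun u hu => ?_).trans (hl w).2) v)
    · simp only [mem_filter, mem_univ, true_and, monochromatic_adj] at hu ⊢
      have := hsame u v hu.2
      exact ⟨⟨hu.1.1, this.1.symm⟩, this.2⟩
    · simp only [mem_filter, mem_univ, true_and, monochromatic_adj] at hu ⊢
      exact ⟨hu.1, hu.2.le⟩

variable {V : Type*}

/-- Colour each class of a colouring with `k` new colours. -/
theorem exists_refine {t T m k a d d' : ℕ} {c g : SimpleGraph V → V → ℕ} (hc : IsLocal t c)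
    (hcm : ∀ G v, c G v < m) (hcd : ∀ G, IsSparse a G → IsSparse d (monochromatic G (c G)))
    (hg : IsLocal T g) (hgk : ∀ G v, g G v < k)
    (hgd : ∀ G, IsSparse d G → IsSparse d' (monochromatic G (g G))) :
    ∃ c' : SimpleGraph V → V → ℕ, IsLocal (t + T) c' ∧ (∀ G v, c' G v < m * k) ∧
      ∀ G, IsSparse a G → IsSparse d' (monochromatic G (c' G)) := by
  refine ⟨fun G v => c G v + m * g (monochromatic G (c G)) v,
    IsLocal.map₂ (fun x y => x + m * y) (hc.mono (Nat.le_add_right t T))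
      (hc.comp_monochromatic hg), fun G v => ?_, fun G hG => ?_⟩
  · have h1 := hcm G v
    have h2 := Nat.mul_le_mul_left m (hgk (monochromatic G (c G)) v)
    rw [Nat.succ_eq_add_one, mul_add] at h2
    dsimp only
    omega
  · have := hgd _ (hcd G hG)
    convert this using 1
    ext u v
    simp only [monochromatic_adj, and_assoc]
    refine and_congr_right fun _ => ⟨fun h => ?_, fun h => by rw [h.1, h.2]⟩
    have hm : 0 < m := (Nat.zero_le _).trans_lt (hcm G u)
    have h1 : c G u = c G v := by
      have := congrArg (· % m) h
      simpa [Nat.mod_eq_of_lt (hcm _ _)] using this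
    rw [h1] at h
    exact ⟨h1, Nat.eq_of_mul_eq_mul_left hm (Nat.add_left_cancel h)⟩

/-- Iterated splitting: `r` times into `k` classes, then once into `4 * 16 ^ r + 1` classes. -/
theorem exists_coloring_of_split {T κ k r a : ℕ} (hk : 0 < k) (hkκ : k ≤ κ)
    (hκ : 4 * 16 ^ r + 1 ≤ κ) (hka : k ^ r ≤ a) (hak : a < (k + 1) ^ r)
    (hsplit : ∀ d k, 0 < k → ∃ g : SimpleGraph V → V → ℕ, IsLocal T g ∧ (∀ G v, g G v < k) ∧
      ∀ G, IsSparse d G → IsSparse (4 * d / k + 4 * d / κ) (monochromatic G (g G))) :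
    ∃ c : SimpleGraph V → V → ℕ, IsLocal ((r + 1) * T) c ∧
      (∀ G v, c G v < (4 * 16 ^ r + 1) * a) ∧
      ∀ G, IsSparse a G → IsSparse 0 (monochromatic G (c G)) := by
  -- As k ≤ κ, each split multiplies the sparsity by at most 8/k.
  have key : ∀ i, ∃ d, d * k ^ i ≤ 8 ^ i * a ∧ ∃ c : SimpleGraph V → V → ℕ, IsLocal (i * T) c ∧
      (∀ G v, c G v < k ^ i) ∧ ∀ G, IsSparse a G → IsSparse d (monochromatic G (c G)) := by
    intro i
    induction i with
    | zero =>
      refine ⟨a, by simp, fun _ _ => 0, fun _ _ _ _ => rfl, by simp, fun G hG => ?_⟩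
      convert hG using 1
      ext u v
      simp [monochromatic_adj]
    | succ i ih =>
      obtain ⟨d, hd, c, hc, hck, hcd⟩ := ih
      obtain ⟨g, hg, hgk, hgd⟩ := hsplit d k hk
      obtain ⟨c', hc', hck', hcd'⟩ := exists_refine hc hck hcd hg hgk hgd
      refine ⟨_, ?_, c', by rwa [Nat.succ_mul], by simpa only [pow_succ] using hck', hcd'⟩
      have h1 : 4 * d / κ ≤ 4 * d / k := Nat.div_le_div_left hkκ hk
      have h2 : 4 * d / k * k ≤ 4 * d := Nat.div_mul_le_self _ _
      calc (4 * d / k + 4 * d / κ) * k ^ (i + 1)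
          ≤ (4 * d / k + 4 * d / k) * k ^ (i + 1) := by gcongr
        _ = 2 * (4 * d / k * k) * k ^ i := by ring
        _ ≤ 2 * (4 * d) * k ^ i := by gcongr
        _ = 8 * (d * k ^ i) := by ring
        _ ≤ 8 * (8 ^ i * a) := by gcongr
        _ = 8 ^ (i + 1) * a := by ring
  obtain ⟨d, hd, c, hc, hck, hcd⟩ := key r
  have hd16 : d < 16 ^ r := by
    have h1 : d * k ^ r < 16 ^ r * k ^ r :=
      calc d * k ^ r ≤ 8 ^ r * a := hd
        _ < 8 ^ r * (k + 1) ^ r := by gcongr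
        _ ≤ 8 ^ r * (2 * k) ^ r := by gcongr; omega
        _ = 16 ^ r * k ^ r := by rw [mul_pow, ← mul_assoc, ← mul_pow]; norm_num
    exact lt_of_mul_lt_mul_right h1 (Nat.zero_le _)
  obtain ⟨g, hg, hgk, hgd⟩ := hsplit d (4 * 16 ^ r + 1) (Nat.succ_pos _)
  -- Since 4d < 4·16^r + 1 ≤ κ, both quotients vanish.
  rw [Nat.div_eq_of_lt (by omega), Nat.div_eq_of_lt (by omega)] at hgd
  obtain ⟨c', hc', hck', hcd'⟩ := exists_refine hc hck hcd hg hgk hgd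
  refine ⟨c', by rwa [Nat.succ_mul], fun G v => (hck' G v).trans_le ?_, hcd'⟩
  rw [mul_comm]
  exact Nat.mul_le_mul_left _ hka

theorem exists_floor_root {r : ℕ} (hr : r ≠ 0) (a : ℕ) : ∃ k, k ^ r ≤ a ∧ a < (k + 1) ^ r := by
  have h : a < (a + 1) ^ r := (Nat.lt_succ_self a).trans_le (Nat.le_self_pow hr _)
  have hex : ∃ k, a < (k + 1) ^ r := ⟨a, h⟩
  refine ⟨Nat.find hex, ?_, Nat.find_spec hex⟩
  rcases hk : Nat.find hex with _ | k
  · simp [hr]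
  · exact not_lt.1 (Nat.find_min hex (m := k) (by omega))

/-- A local algorithm that colours every `a`-sparse graph on `n` vertices with `O(a)` colours. -/
theorem exists_local_coloring (r : ℕ) (hr : r ≠ 0) : ∃ C : ℕ, ∀ n a : ℕ, 1 ≤ a →
    ∃ (T k l : ℕ) (c : SimpleGraph (Fin n) → Fin n → ℕ),
      k ^ r ≤ a ∧ l ^ r ≤ Nat.log 2 n + 1 ∧
      T ≤ C * ((Nat.log 2 n + 1) * (k + l) ^ 2) ∧ IsLocal T c ∧
      (∀ G v, c G v < (4 * 16 ^ r + 1) * a) ∧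
      ∀ G, IsSparse a G → ∀ u v, G.Adj u v → c G u ≠ c G v := by
  set K := 4 * 16 ^ r + 1 with hK
  set D := 2 * r + 3 with hD
  refine ⟨(r + 1) * (3 + 4 * D ^ 2 * (K + 2) ^ 2), fun n a ha => ?_⟩
  set L := Nat.log 2 n + 1 with hL
  have hL1 : 1 ≤ L := Nat.succ_le_succ (Nat.zero_le _)
  have hn : n < 2 ^ L := Nat.lt_pow_succ_log_self one_lt_two n
  obtain ⟨k, hka, hak⟩ := exists_floor_root hr a
  obtain ⟨l, hlL, hLl⟩ := exists_floor_root hr L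
  have hk : 0 < k := by
    rcases Nat.eq_zero_or_pos k with rfl | h
    · simp at hak; omega
    · exact h
  -- The summand l + 1 gives L < κ^r, so q₁ = O(Lκ) is bounded by a power of κ with exponent
  -- depending only on r. This is why constant degree `D` suffices in the second code; 2r + 4 is the
  -- exponent of (κ · κ^r · κ)².
  set κ := k + l + 1 + K with hκ
  have hκ0 : 0 < κ := by omega
  obtain ⟨q₁, hq₁, hlt₁, hle₁⟩ :=
    Nat.exists_prime_lt_and_le_two_mul (L * κ) (Nat.mul_pos hL1 hκ0).ne'
  obtain ⟨q₂, hq₂, hlt₂, hle₂⟩ :=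
    Nat.exists_prime_lt_and_le_two_mul (D * κ) (Nat.mul_pos (by omega) hκ0).ne'
  have hLκ : L ≤ κ ^ r := hLl.le.trans (Nat.pow_le_pow_left (by omega) r)
  have hq₁n : n ≤ q₁ ^ (L + 1) :=
    calc n ≤ 2 ^ L := hn.le
      _ ≤ 2 ^ (L + 1) := Nat.pow_le_pow_right two_pos (Nat.le_succ L)
      _ ≤ q₁ ^ (L + 1) := Nat.pow_le_pow_left hq₁.two_le _
  have hκq₂ : κ ≤ q₂ := le_trans (Nat.le_mul_of_pos_left κ (by omega)) hlt₂.le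
  have hq : q₁ * q₁ ≤ q₂ ^ (D + 1) :=
    calc q₁ * q₁ ≤ (2 * (L * κ)) * (2 * (L * κ)) := Nat.mul_le_mul hle₁ hle₁
      _ ≤ (κ * (κ ^ r * κ)) * (κ * (κ ^ r * κ)) := by
          have : 2 ≤ κ := by omega
          gcongr
      _ = κ ^ (D + 1) := by rw [hD]; ring
      _ ≤ q₂ ^ (D + 1) := Nat.pow_le_pow_left hκq₂ _
  obtain ⟨c, hc, hcK, hcd⟩ := exists_coloring_of_split hk (by omega) (by omega) hka hak
    (exists_split hn hq₁ hq₂ hq₁n hq hL1 (by omega) hlt₁.le hlt₂.le hκ0)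
  refine ⟨_, k, l, c, hka, hlL, ?_, hc, hcK, fun G hG u v huv h =>
    (hcd G hG).not_adj u v ⟨huv, h⟩⟩
  have hκle : κ ≤ (K + 2) * (k + l) := by nlinarith
  have hq₂q₂ : q₂ * q₂ ≤ 4 * D ^ 2 * (K + 2) ^ 2 * (k + l) ^ 2 :=
    calc q₂ * q₂ ≤ (2 * (D * κ)) * (2 * (D * κ)) := Nat.mul_le_mul hle₂ hle₂
      _ = 4 * D ^ 2 * κ ^ 2 := by ring
      _ ≤ 4 * D ^ 2 * ((K + 2) * (k + l)) ^ 2 := by gcongr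
      _ = _ := by ring
  have h3 : L + 2 ≤ 3 * L * (k + l) ^ 2 :=
    calc L + 2 ≤ 3 * L := by omega
      _ ≤ 3 * L * (k + l) ^ 2 := Nat.le_mul_of_pos_right _ (pow_pos (by omega) 2)
  calc (r + 1) * (L + 2 + L * (q₂ * q₂))
      ≤ (r + 1) * (3 * L * (k + l) ^ 2 + L * (4 * D ^ 2 * (K + 2) ^ 2 * (k + l) ^ 2)) := by gcongr
    _ = _ := by ring

end Splitting

/-! ### Full-information simulation in the message-passing model -/

section Simulation

open scoped Classical

/-- What a vertex knows in the full-information protocol: the parameters, its identity number, the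
number of rounds so far, and the graphs on identity numbers that agree with what it has seen. -/
structure Knowledge where
  n : ℕ
  a : ℕ
  id : ℕ
  round : ℕ
  graphs : Set (SimpleGraph ℕ)

/-- The value of `F` at the vertex with identity number `i` of a graph on identity numbers. -/
noncomputable def evalAt {n : ℕ} (F : SimpleGraph (Fin n) → Fin n → ℕ) (H : SimpleGraph ℕ)
    (i : ℕ) : ℕ :=
  if h : i - 1 < n then F (H.comap fun j : Fin n => (j : ℕ) + 1) ⟨i - 1, h⟩ else 0

theorem evalAt_congr {n t : ℕ} {F : SimpleGraph (Fin n) → Fin n → ℕ} (hF : IsLocal t F)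
    {H H' : SimpleGraph ℕ} {i : ℕ} (hi : 1 ≤ i) (h : AgreeNear t H H' i) :
    evalAt F H i = evalAt F H' i := by
  unfold evalAt
  split_ifs with hn
  · refine hF _ _ _ (AgreeNear.comap _ ?_)
    simpa [Nat.sub_add_cancel hi] using h
  · rfl

/-- Collect information for `T n a` rounds, then evaluate `F n a` on a graph that agrees with it. -/
noncomputable def fullInformation (T : ℕ → ℕ → ℕ)
    (F : ∀ n _a : ℕ, SimpleGraph (Fin n) → Fin n → ℕ) : DistributedAlgorithm where
  State := Knowledge
  Msg := Knowledge
  init n a i := ⟨n, a, i, 0, Set.univ⟩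
  send s _ := some s
  -- The condition mirrors the successor case of `AgreeNear`: same neighbours as heard from, and
  -- consistency with what each of them knows.
  receive s msgs := ⟨s.n, s.a, s.id, s.round + 1,
    {H | H ∈ s.graphs ∧ (∀ u, (∃ m, some m ∈ msgs ∧ m.id = u) ↔ H.Adj s.id u) ∧
      ∀ m, some m ∈ msgs → H ∈ m.graphs}⟩
  output s :=
    if s.round = T s.n s.a then
      some (if h : s.graphs.Nonempty then evalAt (F s.n s.a) h.choose s.id + 1 else 0)
    else none

theorem output_fullInformation (T : ℕ → ℕ → ℕ)
    (F : ∀ n _a : ℕ, SimpleGraph (Fin n) → Fin n → ℕ) (s : Knowledge) (hs : s.round = T s.n s.a)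
    (hne : s.graphs.Nonempty) :
    (fullInformation T F).output s = some (evalAt (F s.n s.a) hne.choose s.id + 1) := by
  change (if s.round = T s.n s.a then _ else _) = _
  rw [if_pos hs, dif_pos hne]

namespace Network

variable {V : Type*} [Fintype V] {G : SimpleGraph V}

/-- The graph of the network on the identity numbers. -/
def idGraph (N : Network G) : SimpleGraph ℕ := G.map (⟨N.id, N.id_injective⟩ : V ↪ ℕ)

theorem idGraph_adj (N : Network G) {v : V} {i : ℕ} :
    N.idGraph.Adj (N.id v) i ↔ ∃ u, G.Adj v u ∧ N.id u = i := by
  rw [idGraph, SimpleGraph.map_adj]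
  constructor
  · rintro ⟨x, y, h, hx, rfl⟩
    obtain rfl : x = v := N.id_injective hx
    exact ⟨y, h, rfl⟩
  · rintro ⟨u, h, rfl⟩
    exact ⟨v, u, h, rfl, rfl⟩

theorem id_sub_one_lt (N : Network G) (v : V) : N.id v - 1 < Fintype.card V := by
  have := N.one_le_id v
  have := N.id_le v
  omega

/-- The numbering of the vertices from `0` by their identity numbers. -/
noncomputable def idEquiv (N : Network G) : V ≃ Fin (Fintype.card V) :=
  Equiv.ofBijective (fun v => ⟨N.id v - 1, N.id_sub_one_lt v⟩) <|
    (Fintype.bijective_iff_injective_and_card _).2 ⟨fun u v h => N.id_injective <| by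
      have := N.one_le_id u
      have := N.one_le_id v
      have := congrArg Fin.val h
      simp only at this
      omega, by simp⟩

theorem val_idEquiv_add_one (N : Network G) (v : V) : (N.idEquiv v : ℕ) + 1 = N.id v :=
  Nat.sub_add_cancel (N.one_le_id v)

theorem idGraph_comap (N : Network G) :
    N.idGraph.comap (fun j : Fin (Fintype.card V) => (j : ℕ) + 1) = G.comap N.idEquiv.symm := by
  ext i j
  obtain ⟨u, rfl⟩ := N.idEquiv.surjective i
  obtain ⟨v, rfl⟩ := N.idEquiv.surjective j
  simp only [SimpleGraph.comap_adj, val_idEquiv_add_one, Equiv.symm_apply_apply, idGraph_adj]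
  constructor
  · rintro ⟨w, h, hw⟩
    rwa [← N.id_injective hw]
  · exact fun h => ⟨v, h, rfl⟩

theorem evalAt_idGraph (N : Network G)
    (F : SimpleGraph (Fin (Fintype.card V)) → Fin (Fintype.card V) → ℕ) (v : V) :
    evalAt F N.idGraph (N.id v) = F (G.comap N.idEquiv.symm) (N.idEquiv v) := by
  rw [evalAt, dif_pos (N.id_sub_one_lt v), idGraph_comap]
  rfl

end Network

variable {V : Type*} [Fintype V] [DecidableEq V] {G : SimpleGraph V}

/-- Before round `T` nobody has terminated, so no message is suppressed, and the set of consistent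
graphs evolves exactly by the recursion of `AgreeNear`. -/
theorem stateAfter_fullInformation (T : ℕ → ℕ → ℕ)
    (F : ∀ n _a : ℕ, SimpleGraph (Fin n) → Fin n → ℕ) (a : ℕ) (N : Network G) {t : ℕ}
    (ht : t ≤ T (Fintype.card V) a) (v : V) :
    (fullInformation T F).stateAfter a N t v =
      (⟨Fintype.card V, a, N.id v, t, {H | AgreeNear t N.idGraph H (N.id v)}⟩ : Knowledge) := by
  induction t generalizing v with
  | zero =>
    rw [DistributedAlgorithm.stateAfter]
    simp [fullInformation, AgreeNear]
  | succ t ih =>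
    have ih := ih (Nat.le_of_succ_le ht)
    have hout : ∀ u, ((fullInformation T F).output
        ((fullInformation T F).stateAfter a N t u)).isSome = false := by
      intro u
      rw [ih u]
      simp only [fullInformation]
      rw [if_neg (by omega)]
      rfl
    have hmem : ∀ m : (fullInformation T F).Msg, some m ∈ ((N.ports v).map fun u => (fullInformation T F).emit
        ((fullInformation T F).stateAfter a N t u) ((N.ports u).idxOf v)) ↔
        ∃ u, G.Adj v u ∧ (fullInformation T F).stateAfter a N t u = m := by
      intro m
      refine List.mem_map.trans <| exists_congr fun u => and_congr (N.mem_ports v u) ?_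
      rw [DistributedAlgorithm.emit, hout u]
      exact Option.some_inj
    rw [DistributedAlgorithm.stateAfter, hout v]
    generalize ((N.ports v).map fun u => (fullInformation T F).emit
        ((fullInformation T F).stateAfter a N t u) ((N.ports u).idxOf v)) = msgs at hmem ⊢
    simp only [Bool.false_eq_true, if_false]
    rw [ih v]
    simp only [fullInformation, Knowledge.mk.injEq, true_and]
    ext H
    have hm : ∀ m : Knowledge, some m ∈ msgs ↔ ∃ u, G.Adj v u ∧
        (⟨Fintype.card V, a, N.id u, t, {H | AgreeNear t N.idGraph H (N.id u)}⟩ : Knowledge) = m :=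
      fun m => (hmem m).trans (exists_congr fun u => by rw [ih u]; exact Iff.rfl)
    simp only [Set.mem_ofPred_eq, AgreeNear, N.idGraph_adj]
    refine and_congr_right fun _ => and_congr (forall_congr' fun i => iff_congr ?_ Iff.rfl) ?_
    · constructor
      · rintro ⟨m, h1, h2⟩
        obtain ⟨u, h3, rfl⟩ := (hm m).1 h1
        exact ⟨u, h3, h2⟩
      · rintro ⟨u, h3, rfl⟩
        exact ⟨_, (hm _).2 ⟨u, h3, rfl⟩, rfl⟩
    · constructor
      · rintro h _ ⟨u, h3, rfl⟩
        exact h _ ((hm _).2 ⟨u, h3, rfl⟩)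
      · intro h m h1
        obtain ⟨u, h3, rfl⟩ := (hm m).1 h1
        exact h _ ⟨u, h3, rfl⟩

theorem computesWithin_fullInformation {T : ℕ → ℕ → ℕ}
    {F : ∀ n _a : ℕ, SimpleGraph (Fin n) → Fin n → ℕ} (a : ℕ) (N : Network G)
    (hF : IsLocal (T (Fintype.card V) a) (F (Fintype.card V) a)) :
    (fullInformation T F).ComputesWithin a N (T (Fintype.card V) a)
      fun v => F (Fintype.card V) a (G.comap N.idEquiv.symm) (N.idEquiv v) + 1 := by
  intro v
  rw [stateAfter_fullInformation T F a N le_rfl v]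
  -- The true graph is consistent. The graph chosen may be another one, even a non-sparse one, but
  -- locality of `F` makes the values agree.
  have hne : {H | AgreeNear (T (Fintype.card V) a) N.idGraph H (N.id v)}.Nonempty :=
    ⟨N.idGraph, AgreeNear.refl _ _ _⟩
  refine (output_fullInformation T F _ rfl hne).trans ?_
  exact congrArg (fun x => some (x + 1))
    ((evalAt_congr hF (N.one_le_id v) hne.choose_spec).symm.trans (N.evalAt_idGraph _ v))

end Simulation

/-! ### Bounding the number of rounds -/

section Estimate

open Real

/-- Either a^ε ≤ L^μ and the second term dominates, or L ≤ a^(ε/μ) and the first does. -/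
theorem mul_rpow_le_add {μ ε a L : ℝ} (hμ : 0 < μ) (hε : ε * (1 + 1 / μ) ≤ μ)
    (ha : 1 ≤ a) (hL : 1 ≤ L) : L * a ^ ε ≤ a ^ μ + L ^ (1 + μ) := by
  have ha0 : 0 < a := by linarith
  have hL0 : 0 < L := by linarith
  rcases le_total (a ^ ε) (L ^ μ) with h | h
  · have : L * a ^ ε ≤ L ^ (1 + μ) := by
      rw [rpow_add hL0, rpow_one]
      gcongr
    linarith [rpow_pos_of_pos ha0 μ]
  · have h1 : L ≤ a ^ (ε * (1 / μ)) := by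
      calc L = (L ^ μ) ^ (1 / μ) := by
            rw [← rpow_mul hL0.le, mul_one_div_cancel hμ.ne', rpow_one]
        _ ≤ (a ^ ε) ^ (1 / μ) := rpow_le_rpow (by positivity) h (by positivity)
        _ = a ^ (ε * (1 / μ)) := by rw [rpow_mul ha0.le]
    have : L * a ^ ε ≤ a ^ μ :=
      calc L * a ^ ε ≤ a ^ (ε * (1 / μ)) * a ^ ε := by gcongr
        _ = a ^ (ε * (1 + 1 / μ)) := by rw [← rpow_add ha0]; ring_nf
        _ ≤ a ^ μ := rpow_le_rpow_of_exponent_le ha hε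
    linarith [rpow_pos_of_pos hL0 (1 + μ)]

theorem sq_le_rpow_of_pow_le {r k : ℕ} (hr : r ≠ 0) {x : ℝ} (h : (k : ℝ) ^ r ≤ x) :
    (k : ℝ) ^ 2 ≤ x ^ (2 / (r : ℝ)) := by
  have hr' : (r : ℝ) ≠ 0 := Nat.cast_ne_zero.2 hr
  calc (k : ℝ) ^ 2 = ((k : ℝ) ^ r) ^ (2 / (r : ℝ)) := by
        rw [← rpow_natCast (k : ℝ) r, ← rpow_mul (Nat.cast_nonneg k), mul_div_cancel₀ _ hr']
        norm_cast
    _ ≤ x ^ (2 / (r : ℝ)) := rpow_le_rpow (by positivity) h (by positivity)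

theorem natLog_add_one_rpow_le {p : ℝ} (hp : 0 ≤ p) (n : ℕ) :
    ((Nat.log 2 n + 1 : ℕ) : ℝ) ^ p ≤ 2 ^ p * (1 + logb 2 n ^ p) := by
  have hx : 0 ≤ logb 2 (n : ℝ) := by
    rcases Nat.eq_zero_or_pos n with rfl | h
    · simp
    · exact logb_nonneg one_lt_two (by exact_mod_cast h)
  have hL : ((Nat.log 2 n + 1 : ℕ) : ℝ) ≤ 1 + logb 2 n := by
    rw [Nat.cast_add, Nat.cast_one, add_comm]
    have := natLog_le_logb n 2
    gcongr
    exact_mod_cast this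
  rcases le_total (logb 2 (n : ℝ)) 1 with h | h
  · calc ((Nat.log 2 n + 1 : ℕ) : ℝ) ^ p ≤ 2 ^ p :=
          rpow_le_rpow (by positivity) (by linarith) hp
      _ ≤ 2 ^ p * (1 + logb 2 n ^ p) :=
          le_mul_of_one_le_right (by positivity) (by linarith [rpow_nonneg hx p])
  · calc ((Nat.log 2 n + 1 : ℕ) : ℝ) ^ p ≤ (2 * logb 2 n) ^ p :=
          rpow_le_rpow (by positivity) (by linarith) hp
      _ = 2 ^ p * logb 2 n ^ p := mul_rpow (by norm_num) hx
      _ ≤ 2 ^ p * (1 + logb 2 n ^ p) := by gcongr; linarith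

theorem rounds_le {μ : ℝ} (hμ : 0 < μ) {r : ℕ} (hr : r ≠ 0)
    (hrμ : 2 / (r : ℝ) * (1 + 1 / μ) ≤ μ) {C T k l a n : ℕ} (ha : 1 ≤ a) (hk : k ^ r ≤ a)
    (hl : l ^ r ≤ Nat.log 2 n + 1) (hT : T ≤ C * ((Nat.log 2 n + 1) * (k + l) ^ 2)) :
    (T : ℝ) ≤ C * (2 * (1 + 2 * 2 ^ (1 + μ))) * ((a : ℝ) ^ μ + logb 2 n ^ (1 + μ)) := by
  have hlog := natLog_add_one_rpow_le (p := 1 + μ) (by linarith) n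
  set L := Nat.log 2 n + 1 with hLdef
  have hL : (1 : ℝ) ≤ L := by exact_mod_cast Nat.succ_le_succ (Nat.zero_le _)
  have ha' : (1 : ℝ) ≤ a := by exact_mod_cast ha
  have hk2 := sq_le_rpow_of_pow_le hr (x := (a : ℝ)) (by exact_mod_cast hk)
  have hl2 := sq_le_rpow_of_pow_le hr (x := (L : ℝ)) (by exact_mod_cast hl)
  have h1 := mul_rpow_le_add hμ hrμ ha' hL
  have hεμ : 2 / (r : ℝ) ≤ μ := by
    refine le_trans (le_mul_of_one_le_right (by positivity) ?_) hrμ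
    linarith [one_div_pos.2 hμ]
  have h2 : (L : ℝ) * (L : ℝ) ^ (2 / (r : ℝ)) ≤ (L : ℝ) ^ (1 + μ) := by
    rw [rpow_add (by linarith), rpow_one]
    gcongr
  have hT' : (T : ℝ) ≤ C * (L * (k + l) ^ 2) := by exact_mod_cast hT
  have haμ : (1 : ℝ) ≤ (a : ℝ) ^ μ := one_le_rpow ha' hμ.le
  have hx : 0 ≤ logb 2 (n : ℝ) := by
    rcases Nat.eq_zero_or_pos n with rfl | h
    · simp
    · exact logb_nonneg one_lt_two (by exact_mod_cast h)
  have hxp := rpow_nonneg hx (1 + μ)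
  calc (T : ℝ) ≤ C * (L * (k + l) ^ 2) := hT'
    _ ≤ C * (L * (2 * (k ^ 2 + l ^ 2))) := by
        gcongr
        nlinarith [sq_nonneg ((k : ℝ) - l)]
    _ ≤ C * (L * (2 * ((a : ℝ) ^ (2 / (r : ℝ)) + (L : ℝ) ^ (2 / (r : ℝ))))) := by gcongr
    _ = C * (2 * (L * (a : ℝ) ^ (2 / (r : ℝ)) + L * (L : ℝ) ^ (2 / (r : ℝ)))) := by ring
    _ ≤ C * (2 * (((a : ℝ) ^ μ + L ^ (1 + μ)) + L ^ (1 + μ))) := by gcongr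
    _ = C * (2 * ((a : ℝ) ^ μ + 2 * L ^ (1 + μ))) := by ring
    _ ≤ C * (2 * ((a : ℝ) ^ μ + 2 * (2 ^ (1 + μ) * (1 + logb 2 n ^ (1 + μ))))) := by gcongr
    -- The additive 1, needed when log₂ n is small, is absorbed by a^μ ≥ 1.
    _ ≤ C * (2 * (((a : ℝ) ^ μ + logb 2 n ^ (1 + μ)) +
          2 * (2 ^ (1 + μ) * ((a : ℝ) ^ μ + logb 2 n ^ (1 + μ))))) := by
        gcongr
        linarith
    _ = _ := by ring

end Estimate

theorem mainTheorem10 (μ : ℝ) (hμ : 0 < μ) :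
    ∃ (A : DistributedAlgorithm) (K : ℕ) (C : ℝ),
      ∀ (V : Type*) [Fintype V] [DecidableEq V] (G : SimpleGraph V) (a : ℕ),
        1 ≤ a → arboricity G ≤ a → ∀ N : Network G,
          ∃ (T : ℕ) (φ : V → ℕ),
            (T : ℝ) ≤ C * ((a : ℝ) ^ μ + (Real.logb 2 (Fintype.card V : ℝ)) ^ (1 + μ)) ∧
            A.ComputesWithin a N T φ ∧ IsLegalColoring G (K * a) φ := by
  obtain ⟨r, hr⟩ := exists_nat_ge (max 1 (2 * (1 + 1 / μ) / μ))
  have hr1 : (1 : ℝ) ≤ r := (le_max_left _ _).trans hr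
  have hr0 : r ≠ 0 := by
    rintro rfl
    norm_num at hr1
  have hrμ : 2 / (r : ℝ) * (1 + 1 / μ) ≤ μ := by
    have h := (div_le_iff₀ hμ).1 ((le_max_right _ _).trans hr)
    rw [div_mul_eq_mul_div, div_le_iff₀ (by linarith)]
    linarith
  obtain ⟨C, hC⟩ := exists_local_coloring r hr0
  have hC' : ∀ n a : ℕ, ∃ (T : ℕ) (c : SimpleGraph (Fin n) → Fin n → ℕ), 1 ≤ a →
      ∃ k l : ℕ, k ^ r ≤ a ∧ l ^ r ≤ Nat.log 2 n + 1 ∧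
        T ≤ C * ((Nat.log 2 n + 1) * (k + l) ^ 2) ∧ IsLocal T c ∧
        (∀ G v, c G v < (4 * 16 ^ r + 1) * a) ∧
        ∀ G, IsSparse a G → ∀ u v, G.Adj u v → c G u ≠ c G v := by
    intro n a
    by_cases ha : 1 ≤ a
    · obtain ⟨T, k, l, c, h⟩ := hC n a ha
      exact ⟨T, c, fun _ => ⟨k, l, h⟩⟩
    -- Dummy values for a = 0: the single algorithm must be defined for all parameters.
    · exact ⟨0, fun _ _ => 0, fun h => absurd h ha⟩
  choose T F hTF using hC'
  refine ⟨fullInformation T F, 4 * 16 ^ r + 1, C * (2 * (1 + 2 * 2 ^ (1 + μ))), ?_⟩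
  intro V _ _ G a ha hG N
  obtain ⟨k, l, hk, hl, hT, hlocal, hlt, hproper⟩ := hTF (Fintype.card V) a ha
  refine ⟨_, _, rounds_le hμ hr0 hrμ ha hk hl hT, computesWithin_fullInformation a N hlocal,
    fun v => Finset.mem_Icc.2 ⟨Nat.succ_pos _, hlt _ _⟩, fun u v huv h => ?_⟩
  refine hproper _ ((isSparse_of_arboricity_le hG).comap_equiv N.idEquiv.symm)
    (N.idEquiv u) (N.idEquiv v) ?_ (Nat.add_right_cancel h)
  simpa using huv
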